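/- Let $\Lambda$ be a lattice in $\mathbb{R}^d$, that is, a discrete subgroup spanning $\mathbb{R}^d$ over $\mathbb{R}$, and suppose that $\Lambda$ is rational, i.e. there is a real $c>0$ with $c\langle x,y\rangle\in\mathbb{Q}$ for all $x,y\in\Lambda$. Then $\Lambda$ has a well-rounded sublattice: there is a lattice $\Gamma$ in $\mathbb{R}^d$ with $\Gamma\subseteq\Lambda$ whose non-zero vectors of minimal length span $\mathbb{R}^d$. Moreover, for every non-zero $v\in\Lambda$, the reflection $R_v\colon x\mapsto x-2\frac{\langle x,v\rangle}{\langle v,v\rangle}v$ is a coincidence isometry of $\Lambda$, i.e. $R_v\in OC(\Lambda)$, where $OC(\Lambda)$ is the set of all $R\in O(d)$ such that $\Lambda\cap R\Lambda$ is a sublattice of full rank in $\Lambda$. -/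

import Mathlib

/-- `Λ` is a (full-rank) lattice in `ℝ^d`: a discrete subgroup that spans `ℝ^d` over `ℝ`. -/
def IsLatticeIn (d : ℕ) (Λ : Submodule ℤ (EuclideanSpace ℝ (Fin d))) : Prop :=
  ∃ _ : DiscreteTopology Λ, IsZLattice ℝ Λ

/-- A lattice is rational if its Gram matrix is rational up to a common positive factor: some
positive multiple of the inner product takes rational values on the lattice. -/
def IsRationalLattice (d : ℕ) (Λ : Submodule ℤ (EuclideanSpace ℝ (Fin d))) : Prop :=
  ∃ c : ℝ, 0 < c ∧ ∀ x ∈ Λ, ∀ y ∈ Λ, ∃ q : ℚ, c * inner ℝ x y = (q : ℝ)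

/-- The non-zero vectors of `Λ` of minimal length. -/
def minimalVectors (d : ℕ) (Λ : Submodule ℤ (EuclideanSpace ℝ (Fin d))) :
    Set (EuclideanSpace ℝ (Fin d)) :=
  {v | v ∈ Λ ∧ v ≠ 0 ∧ ∀ w ∈ Λ, w ≠ 0 → ‖v‖ ≤ ‖w‖}

/-- `Λ` is well-rounded: its non-zero vectors of minimal length span `ℝ^d`. -/
def IsWellRounded (d : ℕ) (Λ : Submodule ℤ (EuclideanSpace ℝ (Fin d))) : Prop :=
  Submodule.span ℝ (minimalVectors d Λ) = ⊤

/-- The intersection `Λ(R) = Λ ∩ RΛ` for an isometry `R ∈ O(d)`. -/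
noncomputable def coincidenceSite (d : ℕ) (Λ : Submodule ℤ (EuclideanSpace ℝ (Fin d)))
    (R : EuclideanSpace ℝ (Fin d) ≃ₗᵢ[ℝ] EuclideanSpace ℝ (Fin d)) :
    Submodule ℤ (EuclideanSpace ℝ (Fin d)) :=
  Λ ⊓ Λ.map ((R.toLinearEquiv : EuclideanSpace ℝ (Fin d) →ₗ[ℝ]
    EuclideanSpace ℝ (Fin d)).restrictScalars ℤ)

/-- `OC(Λ)`: the isometries `R ∈ O(d)` such that `Λ ∩ RΛ` is a sublattice of full rank. -/
def coincidenceIsometries (d : ℕ) (Λ : Submodule ℤ (EuclideanSpace ℝ (Fin d))) :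
    Set (EuclideanSpace ℝ (Fin d) ≃ₗᵢ[ℝ] EuclideanSpace ℝ (Fin d)) :=
  {R | IsLatticeIn d (coincidenceSite d Λ R)}

/-- The reflection generated by `v`: the orthogonal reflection in the hyperplane `v^⊥`,
i.e. `x ↦ x - 2 (⟪v, x⟫ / ⟪v, v⟫) v` for `v ≠ 0`. -/
noncomputable def reflectionOf (d : ℕ) (v : EuclideanSpace ℝ (Fin d)) :
    EuclideanSpace ℝ (Fin d) ≃ₗᵢ[ℝ] EuclideanSpace ℝ (Fin d) :=
  (Submodule.span ℝ {v})ᗮ.reflection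

/-!
Let `V` be the rational span of `Λ`. It is dense in `ℝ^d`, every element of `V` has a non-zero
integer multiple in `Λ`, and rationality of `Λ` makes ratios of inner products on `V` rational, so
`R_w` preserves `V` for each `w ∈ V`. Hence `Λ ∩ R_w Λ` contains a multiple of each `x ∈ Λ`, which
is the claim about coincidence isometries.

For the well-rounded sublattice fix `v ∈ Λ`, `v ≠ 0`. Any `u ≠ v` with `‖u‖ = ‖v‖` is a reflection
of `v` (in the hyperplane orthogonal to `v - u`), so by density of `V` the vectors `R_w v ∈ V` with
`w ∈ V` are dense in the sphere of radius `‖v‖`. Choose `d` of them close to an orthogonal basis and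
scale them into `Λ` by a common integer. They have equal length and are almost orthogonal, so they
are linearly independent, and no non-zero integer combination of them is shorter than they are.
-/

open Submodule
open scoped RealInnerProductSpace

section RationalSpan

theorem dense_span_rat {E : Type*} [AddCommGroup E] [Module ℝ E] [Module ℚ E] [TopologicalSpace E]
    [ContinuousAdd E] [ContinuousSMul ℝ E] {s : Set E} (hs : span ℝ s = ⊤) :
    Dense (span ℚ s : Set E) := by
  let closureSpan : Submodule ℝ E :=
    { (span ℚ s).toAddSubmonoid.topologicalClosure with
      smul_mem' := fun a x hx => by
        have ha : a ∈ closure (Set.range ((↑) : ℚ → ℝ)) := Rat.denseRange_cast a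
        refine map_mem_closure₂ continuous_smul ha hx ?_
        rintro _ ⟨q, rfl⟩ y hy
        rw [Rat.cast_smul_eq_qsmul]
        exact (span ℚ s).smul_mem q hy }
  have htop : closureSpan = ⊤ :=
    top_le_iff.mp (hs ▸ span_le.mpr (subset_span.trans subset_closure))
  exact fun x => htop.ge (mem_top (x := x))

variable {M : Type*} [AddCommGroup M] [Module ℚ M] {Λ : Submodule ℤ M}

theorem exists_zsmul_mem_of_mem_span_rat {x : M} (hx : x ∈ span ℚ (Λ : Set M)) :
    ∃ m : ℤ, m ≠ 0 ∧ m • x ∈ Λ := by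
  obtain ⟨m, hm⟩ := multiple_mem_span_of_mem_localization_span (nonZeroDivisors ℤ) ℚ _ x hx
  exact ⟨m, nonZeroDivisors.coe_ne_zero m, by rwa [span_eq] at hm⟩

theorem exists_zsmul_forall_mem_of_mem_span_rat {ι : Type*} [Finite ι] {x : ι → M}
    (hx : ∀ i, x i ∈ span ℚ (Λ : Set M)) : ∃ m : ℤ, m ≠ 0 ∧ ∀ i, m • x i ∈ Λ := by
  cases nonempty_fintype ι
  choose m hm hmem using fun i => exists_zsmul_mem_of_mem_span_rat (hx i)
  refine ⟨∏ i, m i, Finset.prod_ne_zero_iff.mpr fun i _ => hm i, fun i => ?_⟩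
  obtain ⟨k, hk⟩ := Finset.dvd_prod_of_mem m (Finset.mem_univ i)
  rw [hk, mul_comm, mul_smul]
  exact Λ.smul_mem k (hmem i)

end RationalSpan

section Reflection

variable {E : Type*} [NormedAddCommGroup E] [InnerProductSpace ℝ E]

theorem reflection_orthogonal_singleton_apply (v x : E) :
    (span ℝ {v})ᗮ.reflection x = x - (2 * (⟪v, x⟫ / ⟪v, v⟫)) • v := by
  rw [reflection_orthogonal_apply, reflection_singleton_apply, real_inner_self_eq_norm_sq,
    mul_smul, two_smul, two_smul, neg_sub]
  rfl

theorem reflection_orthogonal_singleton_mem [Module ℚ E] {V : Submodule ℚ E} {c : ℝ} (hc : c ≠ 0)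
    (hV : ∀ x ∈ V, ∀ y ∈ V, ∃ q : ℚ, c * ⟪x, y⟫ = q) {v x : E} (hv : v ∈ V) (hx : x ∈ V) :
    (span ℝ {v})ᗮ.reflection x ∈ V := by
  obtain ⟨p, hp⟩ := hV v hv x hx
  obtain ⟨q, hq⟩ := hV v hv v hv
  have hratio : 2 * (⟪v, x⟫ / ⟪v, v⟫) = ((2 * (p / q) : ℚ) : ℝ) := by
    push_cast
    rw [← hp, ← hq, mul_div_mul_left _ _ hc]
  rw [reflection_orthogonal_singleton_apply, hratio, Rat.cast_smul_eq_qsmul]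
  exact V.sub_mem hx (V.smul_mem _ hv)

theorem continuousAt_reflection_orthogonal_singleton {w : E} (hw : w ≠ 0) (x : E) :
    ContinuousAt (fun w => (span ℝ {w})ᗮ.reflection x) w := by
  simp only [reflection_orthogonal_singleton_apply]
  have : ⟪w, w⟫ ≠ 0 := inner_self_ne_zero.mpr hw
  fun_prop (disch := assumption)

theorem sphere_subset_closure_image_reflection {s : Set E} (hs : Dense s) (h0 : 0 ∈ s) (v : E) :
    Metric.sphere 0 ‖v‖ ⊆ closure ((fun w => (span ℝ {w})ᗮ.reflection v) '' s) := by
  intro u hu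
  rcases eq_or_ne v u with rfl | hvu
  · exact subset_closure ⟨0, h0, by
      simp only [reflection_orthogonal_singleton_apply, smul_zero, sub_zero]⟩
  · have himage := mem_closure_image
      (continuousAt_reflection_orthogonal_singleton (sub_ne_zero.mpr hvu) v) (hs (v - u))
    rwa [reflection_sub (mem_sphere_zero_iff_norm.mp hu).symm] at himage

end Reflection

section AlmostOrthogonal

variable {E ι : Type*} [NormedAddCommGroup E] [InnerProductSpace ℝ E]

theorem exists_pairwise_abs_inner_lt_of_mem_closure [Finite ι] {s : Set E} {y : ι → E}
    (hy : ∀ i, y i ∈ closure s) (horth : Pairwise fun i j => ⟪y i, y j⟫ = 0) {δ : ℝ} (hδ : 0 < δ) :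
    ∃ x : ι → E, (∀ i, x i ∈ s) ∧ Pairwise fun i j => |⟪x i, x j⟫| < δ := by
  have hclosure : y ∈ closure (Set.univ.pi fun _ => s) := by
    rw [closure_pi_set]
    exact fun i _ => hy i
  have hnear : ∀ᶠ x in nhds y, Pairwise fun i j => |⟪x i, x j⟫| < δ := by
    simp only [Pairwise, Filter.eventually_all]
    intro i j hij
    have hcont : Continuous fun x : ι → E => |⟪x i, x j⟫| := by fun_prop
    exact hcont.continuousAt.eventually_lt_const (by simpa [horth hij] using hδ)
  obtain ⟨x, hx, hxs⟩ := ((mem_closure_iff_frequently.mp hclosure).and_eventually hnear).exists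
  exact ⟨x, fun i => hx i trivial, hxs⟩

variable [Fintype ι] {b : ι → E} {s δ : ℝ}

theorem norm_sq_sum_smul (a : ι → ℝ) (b : ι → E) :
    ‖∑ i, a i • b i‖ ^ 2 = ∑ i, ∑ j, a i * a j * ⟪b i, b j⟫ := by
  rw [← real_inner_self_eq_norm_sq, sum_inner]
  simp only [inner_sum, real_inner_smul_left, real_inner_smul_right, mul_assoc, mul_left_comm]

theorem mul_sum_sq_le_norm_sq_sum_smul (hnorm : ∀ i, s ≤ ‖b i‖ ^ 2)
    (hinner : Pairwise fun i j => |⟪b i, b j⟫| ≤ δ) (a : ι → ℝ) :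
    (s - (Fintype.card ι - 1) * δ) * ∑ i, a i ^ 2 ≤ ‖∑ i, a i • b i‖ ^ 2 := by
  classical
  have hterm (i j : ι) : (if i = j then (s + δ) * a i ^ 2 else 0) - δ / 2 * (a i ^ 2 + a j ^ 2) ≤
      a i * a j * ⟪b i, b j⟫ := by
    split_ifs with hij
    · subst hij
      rw [real_inner_self_eq_norm_sq]
      linarith [mul_le_mul_of_nonneg_right (hnorm i) (sq_nonneg (a i))]
    · obtain ⟨hlo, hhi⟩ := abs_le.mp (hinner hij)
      -- `a i * a j` is a difference of two squares, so each sign of it is dominated separately.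
      linarith [mul_nonneg (neg_le_iff_add_nonneg.mp hlo) (sq_nonneg (a i + a j)),
        mul_nonneg (sub_nonneg.mpr hhi) (sq_nonneg (a i - a j))]
  calc (s - (Fintype.card ι - 1) * δ) * ∑ i, a i ^ 2
      = ∑ i, ∑ j, ((if i = j then (s + δ) * a i ^ 2 else 0) - δ / 2 * (a i ^ 2 + a j ^ 2)) := by
        simp only [Finset.sum_sub_distrib, Finset.sum_ite_eq, Finset.mem_univ, if_true,
          ← Finset.mul_sum, Finset.sum_add_distrib, Finset.sum_const, Finset.card_univ,
          nsmul_eq_mul]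
        ring
    _ ≤ ∑ i, ∑ j, a i * a j * ⟪b i, b j⟫ :=
        Finset.sum_le_sum fun i _ => Finset.sum_le_sum fun j _ => hterm i j
    _ = ‖∑ i, a i • b i‖ ^ 2 := (norm_sq_sum_smul a b).symm

theorem linearIndependent_of_pairwise_abs_inner_le (hnorm : ∀ i, s ≤ ‖b i‖ ^ 2)
    (hinner : Pairwise fun i j => |⟪b i, b j⟫| ≤ δ) (hδ : (Fintype.card ι - 1) * δ < s) :
    LinearIndependent ℝ b := by
  rw [Fintype.linearIndependent_iff]
  intro a ha
  have hsum : ∑ i, a i ^ 2 ≤ 0 := by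
    have hle := mul_sum_sq_le_norm_sq_sum_smul hnorm hinner a
    rw [ha, norm_zero, zero_pow two_ne_zero] at hle
    exact nonpos_of_mul_nonpos_right hle (sub_pos.mpr hδ)
  have hzero := (Finset.sum_eq_zero_iff_of_nonneg fun i _ => sq_nonneg (a i)).mp
    (hsum.antisymm (Finset.sum_nonneg fun i _ => sq_nonneg (a i)))
  exact fun i => pow_eq_zero_iff two_ne_zero |>.mp (hzero i (Finset.mem_univ i))

theorem le_norm_sq_sum_zsmul (hs : 0 ≤ s) (hnorm : ∀ i, s ≤ ‖b i‖ ^ 2)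
    (hinner : Pairwise fun i j => |⟪b i, b j⟫| ≤ δ) (hδ : 2 * ((Fintype.card ι - 1) * δ) ≤ s)
    {a : ι → ℤ} (ha : a ≠ 0) : s ≤ ‖∑ i, a i • b i‖ ^ 2 := by
  classical
  have one_le_sq {i : ι} (hi : a i ≠ 0) : (1 : ℝ) ≤ (a i : ℝ) ^ 2 := by
    exact_mod_cast (one_le_sq_iff_one_le_abs (a i)).mpr (Int.one_le_abs hi)
  obtain ⟨i, hi⟩ := Function.ne_iff.mp ha
  by_cases hother : ∃ j, j ≠ i ∧ a j ≠ 0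
  · obtain ⟨j, hji, hj⟩ := hother
    have hsum : (2 : ℝ) ≤ ∑ k, (a k : ℝ) ^ 2 := calc
      (2 : ℝ) ≤ (a i : ℝ) ^ 2 + (a j : ℝ) ^ 2 := by linarith [one_le_sq hi, one_le_sq hj]
      _ = ∑ k ∈ {i, j}, (a k : ℝ) ^ 2 := by rw [Finset.sum_pair hji.symm]
      _ ≤ ∑ k, (a k : ℝ) ^ 2 :=
        Finset.sum_le_sum_of_subset_of_nonneg (Finset.subset_univ _) fun _ _ _ => sq_nonneg _
    have hle := mul_sum_sq_le_norm_sq_sum_smul hnorm hinner fun k => (a k : ℝ)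
    simp only [Int.cast_smul_eq_zsmul] at hle
    have hgap : 0 ≤ s - (Fintype.card ι - 1) * δ := by linarith
    linarith [mul_le_mul_of_nonneg_left hsum hgap]
  · push Not at hother
    rw [Finset.sum_eq_single i (fun j _ hj => by rw [hother j hj, zero_smul]) (by simp),
      ← Int.cast_smul_eq_zsmul ℝ, norm_smul, mul_pow, Real.norm_eq_abs, sq_abs]
    exact (hnorm i).trans (le_mul_of_one_le_left (sq_nonneg _) (one_le_sq hi))

theorem le_norm_sq_of_mem_span_int (hs : 0 ≤ s) (hnorm : ∀ i, s ≤ ‖b i‖ ^ 2)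
    (hinner : Pairwise fun i j => |⟪b i, b j⟫| ≤ δ) (hδ : 2 * ((Fintype.card ι - 1) * δ) ≤ s)
    {w : E} (hw : w ∈ span ℤ (Set.range b)) (hw0 : w ≠ 0) : s ≤ ‖w‖ ^ 2 := by
  obtain ⟨a, rfl⟩ := (mem_span_range_iff_exists_fun ℤ).mp hw
  refine le_norm_sq_sum_zsmul hs hnorm hinner hδ ?_
  rintro rfl
  simp at hw0

end AlmostOrthogonal

section Lattice

variable {d : ℕ} {Λ : Submodule ℤ (EuclideanSpace ℝ (Fin d))}

theorem IsLatticeIn.span_eq_top (hΛ : IsLatticeIn d Λ) :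
    span ℝ (Λ : Set (EuclideanSpace ℝ (Fin d))) = ⊤ := by
  obtain ⟨_, hspan⟩ := hΛ
  exact hspan.span_top

theorem IsLatticeIn.of_le {Γ : Submodule ℤ (EuclideanSpace ℝ (Fin d))} (hΛ : IsLatticeIn d Λ)
    (hle : Γ ≤ Λ) (hspan : span ℝ (Γ : Set (EuclideanSpace ℝ (Fin d))) = ⊤) :
    IsLatticeIn d Γ := by
  obtain ⟨hdiscrete, _⟩ := hΛ
  have : DiscreteTopology Γ := DiscreteTopology.of_subset (s := (Λ : Set _)) hdiscrete hle
  exact ⟨this, ⟨hspan⟩⟩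

theorem IsLatticeIn.exists_mem_ne_zero [NeZero d] (hΛ : IsLatticeIn d Λ) : ∃ v ∈ Λ, v ≠ 0 := by
  rw [← Λ.ne_bot_iff]
  rintro rfl
  simpa using hΛ.span_eq_top

theorem IsWellRounded.span_eq_top (hΛ : IsWellRounded d Λ) :
    span ℝ (Λ : Set (EuclideanSpace ℝ (Fin d))) = ⊤ :=
  top_le_iff.mp (hΛ.ge.trans (span_mono fun _ hx => hx.1))

theorem isWellRounded_span_of_pairwise_abs_inner_le {b : Fin d → EuclideanSpace ℝ (Fin d)}
    {r δ : ℝ} (hr : 0 < r) (hnorm : ∀ i, ‖b i‖ = r)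
    (hinner : Pairwise fun i j => |⟪b i, b j⟫| ≤ δ) (hδ : 2 * ((d - 1) * δ) ≤ r ^ 2) :
    IsWellRounded d (span ℤ (Set.range b)) := by
  have hr2 : 0 < r ^ 2 := pow_pos hr 2
  have hnorm_sq (i : Fin d) : r ^ 2 ≤ ‖b i‖ ^ 2 := by rw [hnorm i]
  have hli : LinearIndependent ℝ b :=
    linearIndependent_of_pairwise_abs_inner_le hnorm_sq hinner
      (by rw [Fintype.card_fin]; linarith)
  rw [IsWellRounded, ← top_le_iff, ← hli.span_eq_top_of_card_eq_finrank' (by simp)]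
  refine span_mono ?_
  rintro _ ⟨i, rfl⟩
  refine ⟨subset_span ⟨i, rfl⟩, hli.ne_zero i, fun w hw hw0 => ?_⟩
  rw [hnorm, ← sq_le_sq₀ hr.le (norm_nonneg w)]
  exact le_norm_sq_of_mem_span_int hr2.le hnorm_sq hinner (by rwa [Fintype.card_fin]) hw hw0

theorem mem_coincidenceIsometries_of_symm_mem_span_rat (hΛ : IsLatticeIn d Λ)
    {R : EuclideanSpace ℝ (Fin d) ≃ₗᵢ[ℝ] EuclideanSpace ℝ (Fin d)}
    (hR : ∀ x ∈ Λ, R.symm x ∈ span ℚ (Λ : Set (EuclideanSpace ℝ (Fin d)))) :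
    R ∈ coincidenceIsometries d Λ := by
  refine hΛ.of_le inf_le_left ?_
  rw [← top_le_iff, ← hΛ.span_eq_top, span_le]
  intro x hx
  obtain ⟨m, hm, hmem⟩ := exists_zsmul_mem_of_mem_span_rat (hR x hx)
  have hmx : m • x ∈ coincidenceSite d Λ R :=
    ⟨Λ.smul_mem m hx, m • R.symm x, hmem, by simp⟩
  rw [SetLike.mem_coe, ← smul_mem_iff _ (Int.cast_ne_zero (α := ℝ).mpr hm),
    Int.cast_smul_eq_zsmul]
  exact subset_span hmx

end Lattice

section RationalLattice

variable {d : ℕ} {Λ : Submodule ℤ (EuclideanSpace ℝ (Fin d))}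

theorem IsRationalLattice.exists_mul_inner_eq_ratCast (hrat : IsRationalLattice d Λ) :
    ∃ c : ℝ, 0 < c ∧ ∀ x ∈ span ℚ (Λ : Set (EuclideanSpace ℝ (Fin d))),
      ∀ y ∈ span ℚ (Λ : Set (EuclideanSpace ℝ (Fin d))), ∃ q : ℚ, c * ⟪x, y⟫ = q := by
  obtain ⟨c, hc, hΛ⟩ := hrat
  refine ⟨c, hc, fun x hx y hy => ?_⟩
  obtain ⟨m, hm, hmx⟩ := exists_zsmul_mem_of_mem_span_rat hx
  obtain ⟨n, hn, hny⟩ := exists_zsmul_mem_of_mem_span_rat hy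
  obtain ⟨q, hq⟩ := hΛ _ hmx _ hny
  refine ⟨q / (m * n), ?_⟩
  simp only [← Int.cast_smul_eq_zsmul ℝ, real_inner_smul_left, real_inner_smul_right] at hq
  push_cast
  rw [← hq]
  field_simp

theorem IsRationalLattice.reflectionOf_mem_span_rat (hrat : IsRationalLattice d Λ)
    {v x : EuclideanSpace ℝ (Fin d)} (hv : v ∈ span ℚ (Λ : Set (EuclideanSpace ℝ (Fin d))))
    (hx : x ∈ span ℚ (Λ : Set (EuclideanSpace ℝ (Fin d)))) :
    reflectionOf d v x ∈ span ℚ (Λ : Set (EuclideanSpace ℝ (Fin d))) := by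
  obtain ⟨c, hc, hinner⟩ := hrat.exists_mul_inner_eq_ratCast
  exact reflection_orthogonal_singleton_mem hc.ne' hinner hv hx

theorem IsRationalLattice.reflectionOf_mem_coincidenceIsometries (hrat : IsRationalLattice d Λ)
    (hΛ : IsLatticeIn d Λ) {v : EuclideanSpace ℝ (Fin d)}
    (hv : v ∈ span ℚ (Λ : Set (EuclideanSpace ℝ (Fin d)))) :
    reflectionOf d v ∈ coincidenceIsometries d Λ :=
  mem_coincidenceIsometries_of_symm_mem_span_rat hΛ fun _ hx =>
    hrat.reflectionOf_mem_span_rat hv (subset_span hx)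

theorem IsRationalLattice.sphere_subset_closure_span_rat (hrat : IsRationalLattice d Λ)
    (hspan : span ℝ (Λ : Set (EuclideanSpace ℝ (Fin d))) = ⊤) {v : EuclideanSpace ℝ (Fin d)}
    (hv : v ∈ span ℚ (Λ : Set (EuclideanSpace ℝ (Fin d)))) :
    Metric.sphere 0 ‖v‖ ⊆
      closure {x | x ∈ span ℚ (Λ : Set (EuclideanSpace ℝ (Fin d))) ∧ ‖x‖ = ‖v‖} := by
  refine (sphere_subset_closure_image_reflection (dense_span_rat hspan)
    (zero_mem _) v).trans (closure_mono ?_)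
  rintro _ ⟨w, hw, rfl⟩
  exact ⟨hrat.reflectionOf_mem_span_rat hw hv, by simp⟩

theorem IsRationalLattice.exists_mem_norm_eq_pairwise_abs_inner_le (hrat : IsRationalLattice d Λ)
    (hspan : span ℝ (Λ : Set (EuclideanSpace ℝ (Fin d))) = ⊤)
    {v : EuclideanSpace ℝ (Fin d)} (hv : v ∈ span ℚ (Λ : Set (EuclideanSpace ℝ (Fin d))))
    (hv0 : v ≠ 0) {ε : ℝ} (hε : 0 < ε) :
    ∃ r : ℝ, 0 < r ∧ ∃ b : Fin d → EuclideanSpace ℝ (Fin d), (∀ i, b i ∈ Λ) ∧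
      (∀ i, ‖b i‖ = r) ∧ Pairwise fun i j => |⟪b i, b j⟫| ≤ ε * r ^ 2 := by
  let e := EuclideanSpace.basisFun (Fin d) ℝ
  have : 0 < ‖v‖ := norm_pos_iff.mpr hv0
  have hclosure (i : Fin d) := hrat.sphere_subset_closure_span_rat hspan hv
    (show ‖v‖ • e i ∈ Metric.sphere 0 ‖v‖ by simp [norm_smul])
  have horth : Pairwise fun i j => ⟪‖v‖ • e i, ‖v‖ • e j⟫ = 0 := fun i j hij => by
    simp only [real_inner_smul_left, real_inner_smul_right, e.orthonormal.2 hij, mul_zero]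
  obtain ⟨x, hx, hinner⟩ := exists_pairwise_abs_inner_lt_of_mem_closure hclosure horth
    (δ := ε * ‖v‖ ^ 2) (by positivity)
  obtain ⟨m, hm, hmem⟩ := exists_zsmul_forall_mem_of_mem_span_rat fun i => (hx i).1
  have : (m : ℝ) ≠ 0 := Int.cast_ne_zero.mpr hm
  refine ⟨|(m : ℝ)| * ‖v‖, by positivity, fun i => m • x i, hmem, fun i => ?_, fun i j hij => ?_⟩
  · simp only [← Int.cast_smul_eq_zsmul ℝ, norm_smul, (hx i).2, Real.norm_eq_abs]
  · simp only [← Int.cast_smul_eq_zsmul ℝ, real_inner_smul_left, real_inner_smul_right]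
    calc |(m : ℝ) * (m * ⟪x i, x j⟫)| = (m : ℝ) ^ 2 * |⟪x i, x j⟫| := by
          rw [← mul_assoc, abs_mul, abs_mul_self, sq]
      _ ≤ (m : ℝ) ^ 2 * (ε * ‖v‖ ^ 2) := by gcongr; exact (hinner hij).le
      _ = ε * (|(m : ℝ)| * ‖v‖) ^ 2 := by rw [mul_pow, sq_abs]; ring

theorem IsRationalLattice.exists_isWellRounded_le (hrat : IsRationalLattice d Λ)
    (hΛ : IsLatticeIn d Λ) : ∃ Γ ≤ Λ, IsLatticeIn d Γ ∧ IsWellRounded d Γ := by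
  rcases eq_zero_or_neZero d with rfl | _
  · exact ⟨Λ, le_rfl, hΛ, Subsingleton.elim _ _⟩
  have hd : (0 : ℝ) < d := Nat.cast_pos.mpr (NeZero.pos d)
  obtain ⟨v, hv, hv0⟩ := hΛ.exists_mem_ne_zero
  obtain ⟨r, hr, b, hbΛ, hnorm, hinner⟩ :=
    hrat.exists_mem_norm_eq_pairwise_abs_inner_le hΛ.span_eq_top (subset_span hv) hv0
      (ε := (2 * d)⁻¹) (by positivity)
  have hwr : IsWellRounded d (span ℤ (Set.range b)) := by
    refine isWellRounded_span_of_pairwise_abs_inner_le hr hnorm hinner ?_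
    calc 2 * ((d - 1) * ((2 * d : ℝ)⁻¹ * r ^ 2)) ≤ 2 * (d * ((2 * d : ℝ)⁻¹ * r ^ 2)) := by
          gcongr; linarith
      _ = r ^ 2 := by field_simp
  have hle : span ℤ (Set.range b) ≤ Λ := span_le.mpr (Set.range_subset_iff.mpr hbΛ)
  exact ⟨_, hle, hΛ.of_le hle hwr.span_eq_top, hwr⟩

end RationalLattice

theorem mainTheorem3 (d : ℕ) (Λ : Submodule ℤ (EuclideanSpace ℝ (Fin d)))
    (hΛ : IsLatticeIn d Λ) (hrat : IsRationalLattice d Λ) :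
    (∃ Γ : Submodule ℤ (EuclideanSpace ℝ (Fin d)),
      Γ ≤ Λ ∧ IsLatticeIn d Γ ∧ IsWellRounded d Γ) ∧
    (∀ v ∈ Λ, v ≠ 0 → reflectionOf d v ∈ coincidenceIsometries d Λ) :=
  ⟨hrat.exists_isWellRounded_le hΛ,
    fun _ hv _ => hrat.reflectionOf_mem_coincidenceIsometries hΛ (subset_span hv)⟩
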